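/- For integers $r\ge k\ge 1$, an $(r,k)$-colouring of the complete graph $K_n$ assigns to every edge a $k$-element subset of $[r]=\{1,\dots,r\}$. A path or cycle in $K_n$ is called monochromatic if some colour $i\in[r]$ belongs to the colour sets of all its edges; single vertices count as paths, and single vertices and single edges also count as cycles. Let $\mathrm{pp}(r,k)$ (respectively $\mathrm{cp}(r,k)$) be the minimum number $m$ such that for every $n$ and every $(r,k)$-colouring of $K_n$, the vertex set of $K_n$ can be partitioned into the vertex sets of at most $m$ monochromatic paths (respectively cycles), not necessarily all of the same colour. Then for every integer $r\ge 2$, $$\mathrm{cp}(r,r-1)=\mathrm{pp}(r,r-1)=2.$$ -/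

import Mathlib

namespace SetColouring

/-- An `(r,k)`-colouring of `G`: every edge receives a set of exactly `k` of the `r` colours. -/
abbrev Colouring {V : Type*} (G : SimpleGraph V) (r k : ℕ) : Type _ :=
  G.EdgeLabeling {c : Finset (Fin r) // c.card = k}

variable {V : Type*} {G : SimpleGraph V} {r k : ℕ}

/-- Some single colour belongs to the colour set of every edge of the walk. -/
def IsMonochromatic (φ : Colouring G r k) {u v : V} (p : G.Walk u v) : Prop :=
  ∃ i : Fin r, ∀ (e : Sym2 V) (he : e ∈ p.edges),
    i ∈ (φ ⟨e, p.edges_subset_edgeSet he⟩ : {c : Finset (Fin r) // c.card = k}).1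

/-- `S` is the vertex set of a monochromatic path (a single vertex is a path of length `0`). -/
def IsMonoPathSet (φ : Colouring G r k) (S : Finset V) : Prop :=
  ∃ (u v : V) (p : G.Walk u v), p.IsPath ∧ IsMonochromatic φ p ∧ ∀ x, x ∈ S ↔ x ∈ p.support

/-- `S` is the vertex set of a monochromatic cycle.  As usual for cycle partitions, single
vertices and single edges (that is, paths of length at most `1`) count as cycles. -/
def IsMonoCycleSet (φ : Colouring G r k) (S : Finset V) : Prop :=
  (∃ (u v : V) (p : G.Walk u v), p.IsPath ∧ p.length ≤ 1 ∧ IsMonochromatic φ p ∧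
      ∀ x, x ∈ S ↔ x ∈ p.support) ∨
    ∃ (u : V) (p : G.Walk u u), p.IsCycle ∧ IsMonochromatic φ p ∧ ∀ x, x ∈ S ↔ x ∈ p.support

/-- The vertices can be partitioned into at most `m` monochromatic paths. -/
def HasPathPartition [Fintype V] [DecidableEq V] (φ : Colouring G r k) (m : ℕ) : Prop :=
  ∃ P : Finpartition (Finset.univ : Finset V),
    P.parts.card ≤ m ∧ ∀ S ∈ P.parts, IsMonoPathSet φ S

/-- The vertices can be partitioned into at most `m` monochromatic cycles. -/
def HasCyclePartition [Fintype V] [DecidableEq V] (φ : Colouring G r k) (m : ℕ) : Prop :=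
  ∃ P : Finpartition (Finset.univ : Finset V),
    P.parts.card ≤ m ∧ ∀ S ∈ P.parts, IsMonoCycleSet φ S

/-- `m` paths suffice for every `(r,k)`-colouring of every complete graph. -/
def PathsSuffice (r k m : ℕ) : Prop :=
  ∀ (n : ℕ) (φ : Colouring (⊤ : SimpleGraph (Fin n)) r k), HasPathPartition φ m

/-- `m` cycles suffice for every `(r,k)`-colouring of every complete graph. -/
def CyclesSuffice (r k m : ℕ) : Prop :=
  ∀ (n : ℕ) (φ : Colouring (⊤ : SimpleGraph (Fin n)) r k), HasCyclePartition φ m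

/-- The path partition number `pp(r,k)`, as a predicate: `m` is the least number of monochromatic
paths that suffices. -/
def IsPathPartitionNumber (r k m : ℕ) : Prop := IsLeast {m' | PathsSuffice r k m'} m

/-- The cycle partition number `cp(r,k)`, as a predicate: `m` is the least number of monochromatic
cycles that suffices. -/
def IsCyclePartitionNumber (r k m : ℕ) : Prop := IsLeast {m' | CyclesSuffice r k m'} m

end SetColouring

/-! Upper bound. An edge misses only one colour, so of two fixed colours every edge carries at least
one (`hasColour_or_of_ne`). It therefore suffices to split a complete graph, whose edges are red
(`R`) or blue (`B`) or both, into two monochromatic cycles; they may have the same colour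
(`IsTotalPair.exists_two_closedChains`). Take a red cycle `C` and a blue path from `x` to `y`
covering everything, with `C` as long as possible. If the path does not close to a blue cycle, then
`xy` is red. Let `u` mark the vertices with a red edge to `x` or `y`. Maximality of `C` shows that
no two consecutive vertices of `C` are marked, and that the successors of marked vertices are
pairwise blue, as are their predecessors. If the two neighbours on `C` of an unmarked vertex are
joined in red, that vertex can leave `C` and close the blue path, which finishes; otherwise the pair
is blue. Walking around `C` in steps of two then splits it into a blue path with unmarked ends and a
blue cycle (`Enumerates.exists_chain_append_closedChain`), and the blue path closes up through `x`
and `y`. Lower bound. Vertices get levels, level `i` having two more vertices than all lower levels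
together, and an edge omits the smaller level of its ends. On a path of colour `i`, vertices of
level `i` are separated by vertices of lower level, of which there are too few for one path to cover
everything. -/

namespace SetColouring

/-! ### Red and blue chains in a two-coloured complete graph. -/

section TwoRelations

variable {α : Type*} {R B : α → α → Prop}

/-- A chain whose last element is related to its first one. -/
def IsClosedChain (R : α → α → Prop) (l : List α) : Prop :=
  l.IsChain R ∧ ∀ x ∈ l.head?, ∀ y ∈ l.getLast?, R y x

/-- Two reflexive and symmetric relations such that any two elements are related by one of them:
the edges of a complete graph, coloured with two possibly overlapping colours. -/
structure IsTotalPair (R B : α → α → Prop) : Prop where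
  refl_left : ∀ x, R x x
  refl_right : ∀ x, B x x
  symm_left : ∀ {x y}, R x y → R y x
  symm_right : ∀ {x y}, B x y → B y x
  total : ∀ x y, R x y ∨ B x y

theorem IsClosedChain.nil : IsClosedChain R [] := by
  simp [IsClosedChain]

theorem IsClosedChain.singleton (x : α) (h : R x x) : IsClosedChain R [x] := by
  simp [IsClosedChain, h]

theorem isChain_reverse_of_symm (hR : ∀ {x y}, R x y → R y x) {l : List α} (h : l.IsChain R) :
    l.reverse.IsChain R := by
  rw [List.isChain_reverse]
  exact h.imp fun _ _ => hR

/-- If a new element `v` extends neither chain at its head, then it is blue to the red head `a` and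
red to the blue head `b`. The colour of `ab` decides which chain takes `v` and the other head. -/
theorem IsTotalPair.exists_chain_partition (h : IsTotalPair R B) (vs : List α) :
    ∃ l m : List α, (l ++ m).Perm vs ∧ l.IsChain R ∧ m.IsChain B := by
  induction vs with
  | nil => exact ⟨[], [], by simp⟩
  | cons v vs ih =>
    obtain ⟨l, m, hp, hl, hm⟩ := ih
    have hp' : (l ++ v :: m).Perm (v :: vs) := List.perm_middle.trans (hp.cons v)
    rcases l with _ | ⟨a, l⟩
    · exact ⟨[v], m, by simpa using hp, by simp, hm⟩
    rcases m with _ | ⟨b, m⟩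
    · exact ⟨a :: l, [v], hp', hl, by simp⟩
    rcases h.total v a with hva | hva
    · exact ⟨v :: a :: l, b :: m, hp.cons v, by simp [hva, hl], hm⟩
    rcases h.total v b with hvb | hvb
    · rcases h.total b a with hba | hba
      · refine ⟨v :: b :: a :: l, m, ?_, by simp [hvb, hba, hl], hm.tail⟩
        exact (List.Perm.cons v (List.perm_middle (l₁ := a :: l)).symm).trans (hp.cons v)
      · refine ⟨l, v :: a :: b :: m, ?_, hl.tail, by simp [hva, h.symm_right hba, hm]⟩
        refine List.perm_middle.trans (List.Perm.cons v ?_)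
        exact List.perm_middle.trans hp
    · exact ⟨a :: l, v :: b :: m, hp', hl, by simp [hvb, hm]⟩

theorem exists_pair_length_maximal {Q : List α → List α → Prop} {N : ℕ}
    (hN : ∀ l m, Q l m → l.length ≤ N) (h : ∃ l m, Q l m) :
    ∃ l m, Q l m ∧ ∀ l' m', Q l' m' → l'.length ≤ l.length := by
  classical
  obtain ⟨l₀, m₀, h₀⟩ := h
  have hex : ∃ k, ∃ l m, Q l m ∧ l.length + k = N :=
    ⟨N - l₀.length, l₀, m₀, h₀, by have := hN _ _ h₀; omega⟩
  obtain ⟨l, m, hQ, hk⟩ := Nat.find_spec hex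
  refine ⟨l, m, hQ, fun l' m' h' => ?_⟩
  have := Nat.find_min' hex ⟨l', m', h', Nat.add_sub_cancel' (hN _ _ h')⟩
  have := hN _ _ h'
  omega

/-- Here the blue chain is chosen longest. No end of the red chain can then move to its head `x`, so
`x` is red to both ends and closes the red chain. -/
theorem IsTotalPair.exists_closedChain_partition (h : IsTotalPair R B) (vs : List α) :
    ∃ l m : List α, (l ++ m).Perm vs ∧ IsClosedChain R l ∧ m.IsChain B := by
  obtain ⟨m, l, ⟨hp, hl, hm⟩, hmax⟩ := exists_pair_length_maximal
    (Q := fun m l => (l ++ m).Perm vs ∧ l.IsChain R ∧ m.IsChain B) (N := vs.length)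
    (by rintro l m ⟨hp, -⟩; have := hp.length_eq; simp at this; omega)
    (by obtain ⟨l, m, hp⟩ := h.exists_chain_partition vs; exact ⟨m, l, hp⟩)
  rcases l with _ | ⟨a, l⟩
  · exact ⟨[], m, hp, .nil, hm⟩
  rcases m with _ | ⟨x, m⟩
  · have := hmax [a] l ⟨(List.perm_append_singleton a l).trans (by simpa using hp), hl.tail, by simp⟩
    simp at this
  have hx : R x a := by
    refine (h.total x a).resolve_right fun hxa => ?_
    have := hmax (a :: x :: m) l ⟨List.perm_middle.trans hp, hl.tail,
      by simp [h.symm_right hxa, hm]⟩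
    simp at this
  refine ⟨x :: a :: l, m, List.perm_middle.symm.trans hp, ⟨by simp [hx, hl], ?_⟩, hm.tail⟩
  intro y hy z hz
  obtain rfl : x = y := by simpa using hy
  refine (h.total z x).resolve_right fun hzx => ?_
  obtain ⟨l', hl'⟩ : ∃ l', a :: l = l' ++ [z] := by
    rw [List.getLast?_cons_cons] at hz
    obtain ⟨h1, h2⟩ := List.mem_getLast?_eq_getLast hz
    exact ⟨(a :: l).dropLast, by rw [h2, List.dropLast_append_getLast]⟩
  rw [hl'] at hp hl
  have := hmax (z :: x :: m) l' ⟨by simpa using hp, hl.left_of_append, by simp [hzx, hm]⟩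
  simp at this

/-- The breaks cut the list into `B`-segments that end in `M` and, after the first, start in `P`.
Reversing every second segment makes the joints alternately `M`–`M` and `P`–`P`, hence `B`-related.
The second conclusion has the first segment reversed; its joint at `a` is left open because `a`
itself need not satisfy `P`. -/
theorem exists_chain_perm_of_breaks {M P : α → Prop} (hB : ∀ {x y}, B x y → B y x)
    (hM : ∀ x y, M x → M y → B x y) (hP : ∀ x y, P x → P y → B x y) (s : List α) (a : α)
    (hs : (a :: s).IsChain fun x y => B x y ∨ M x ∧ P y)
    (hlast : ∀ z ∈ (a :: s).getLast?, M z) :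
    (∃ l, (a :: l).Perm (a :: s) ∧ (a :: l).IsChain B ∧
      ∀ z ∈ (a :: l).getLast?, M z ∨ P z) ∧
    ∃ l₁ l₂, (l₁ ++ a :: l₂).Perm (a :: s) ∧ (l₁ ++ [a]).IsChain B ∧ l₂.IsChain B ∧
      (∀ z ∈ (l₁ ++ [a]).head?, M z) ∧ (∀ z ∈ l₂.head?, P z) ∧
      ∀ z ∈ l₂.getLast?, M z ∨ P z := by
  induction s generalizing a with
  | nil =>
    have ha : M a := by simpa using hlast
    exact ⟨⟨[], by simp [ha]⟩, [], [], by simp [ha]⟩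
  | cons b s ih =>
    rw [List.isChain_cons_cons] at hs
    obtain ⟨⟨l, hl, hlc, hll⟩, l₁, l₂, hp, hc₁, hc₂, hh₁, hh₂, hl₂⟩ :=
      ih b hs.2 (by simpa using hlast)
    rcases hs.1 with hab | ⟨ha, hb⟩
    · refine ⟨⟨b :: l, hl.cons a, by simp [hab, hlc], by simpa using hll⟩,
        l₁ ++ [b], l₂, ?_, ?_, hc₂, ?_, hh₂, hl₂⟩
      · refine List.perm_middle.trans (List.Perm.cons a ?_)
        simpa using hp
      · rw [List.isChain_append]
        exact ⟨hc₁, by simp, by simpa using hB hab⟩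
      · simpa using hh₁
    · refine ⟨⟨l₁ ++ b :: l₂, hp.cons a, ?_, ?_⟩, [], b :: l, hl.cons a, by simp, hlc, by simpa,
        by simpa using hb, hll⟩
      · have : l₁ ++ b :: l₂ = (l₁ ++ [b]) ++ l₂ := by simp
        rw [this, List.isChain_cons, List.isChain_append]
        refine ⟨fun y hy => hM _ _ ha (hh₁ y ?_), hc₁, hc₂, fun x hx y hy => ?_⟩
        · rwa [List.head?_append_of_ne_nil _ (by simp)] at hy
        · obtain rfl : b = x := by simpa using hx
          exact hP _ _ hb (hh₂ y hy)
      · intro z hz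
        rcases List.eq_nil_or_concat l₂ with rfl | ⟨l', z', rfl⟩
        · obtain rfl : b = z := by simpa [List.getLast?_cons, List.getLast?_append] using hz
          exact .inr hb
        · apply hl₂
          simpa [List.getLast?_cons, List.getLast?_append] using hz

end TwoRelations

/-! ### Periodic indexing of a cyclic list, and steps of one or two around it. -/

section Progression

variable {α : Type*} {R B : α → α → Prop}

/-- The list `c s, c (s + d), …, c (s + d * (k - 1))`. -/
def progression (c : ℕ → α) (s d k : ℕ) : List α :=
  (List.range k).map fun j => c (s + d * j)

theorem length_progression (c : ℕ → α) (s d k : ℕ) : (progression c s d k).length = k := by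
  simp [progression]

theorem progression_succ (c : ℕ → α) (s d k : ℕ) :
    progression c s d (k + 1) = progression c s d k ++ [c (s + d * k)] := by
  simp [progression, List.range_succ]

theorem head?_progression (c : ℕ → α) (s d : ℕ) {k : ℕ} (hk : 0 < k) :
    (progression c s d k).head? = some (c s) := by
  obtain ⟨k, rfl⟩ := Nat.exists_eq_add_of_lt hk
  simp [progression, List.range_succ_eq_map]

theorem getLast?_progression (c : ℕ → α) (s d k : ℕ) :
    (progression c s d (k + 1)).getLast? = some (c (s + d * k)) := by
  simp [progression_succ]

theorem isChain_progression {c : ℕ → α} {d : ℕ} (h : ∀ i, R (c i) (c (i + d))) (s k : ℕ) :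
    (progression c s d k).IsChain R := by
  induction k with
  | zero => simp [progression]
  | succ k ih =>
    rw [progression_succ, List.isChain_append]
    refine ⟨ih, by simp, fun x hx y hy => ?_⟩
    obtain rfl : c (s + d * k) = y := by simpa using hy
    rcases k with _ | k
    · simp [progression] at hx
    · rw [getLast?_progression] at hx
      obtain rfl : c (s + d * k) = x := by simpa using hx
      simpa [mul_add, add_assoc] using h (s + d * k)

/-- `c` runs periodically through the list `C`. -/
def Enumerates (c : ℕ → α) (C : List α) : Prop :=
  C = progression c 0 1 C.length ∧ ∀ i, c (i % C.length) = c i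

theorem exists_enumerates {C : List α} (hC : C ≠ []) : ∃ c : ℕ → α, Enumerates c C := by
  have hp : 0 < C.length := List.length_pos_iff.2 hC
  refine ⟨fun i => C[i % C.length]'(Nat.mod_lt _ hp), ?_, fun i => by simp⟩
  apply List.ext_getElem
  · simp [progression]
  · intro i h₁ h₂
    simp [progression, Nat.mod_eq_of_lt h₁]

theorem Enumerates.congr {c : ℕ → α} {C : List α} (h : Enumerates c C) {i j : ℕ}
    (hij : i ≡ j [MOD C.length]) : c i = c j := by
  rw [← h.2 i, ← h.2 j, hij]

theorem Enumerates.add_length {c : ℕ → α} {C : List α} (h : Enumerates c C) (i : ℕ) :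
    c (i + C.length) = c i :=
  h.congr (by simp [Nat.ModEq])

theorem Enumerates.map_perm {c : ℕ → α} {C : List α} (h : Enumerates c C) {I : List ℕ}
    (hI : (I.map (· % C.length)).Nodup) (hl : I.length = C.length) : (I.map c).Perm C := by
  rcases Nat.eq_zero_or_pos C.length with hp | hp
  · rw [hp] at hl
    rw [List.length_eq_zero_iff.1 hp, List.length_eq_zero_iff.1 hl]
    simp
  have hperm : (I.map (· % C.length)).Perm (List.range C.length) := by
    refine (List.subperm_of_subset hI fun x hx => ?_).perm_of_length_le (by simp [hl])
    obtain ⟨i, -, rfl⟩ := List.mem_map.1 hx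
    simpa using Nat.mod_lt _ hp
  have h₁ : I.map c = (I.map (· % C.length)).map c := by
    rw [List.map_map]
    exact List.map_congr_left fun i _ => (h.2 i).symm
  rw [h₁]
  refine (hperm.map c).trans (List.Perm.of_eq ?_)
  conv_rhs => rw [h.1]
  simp [progression]

theorem Enumerates.progression_one_perm {c : ℕ → α} {C : List α} (h : Enumerates c C) (s : ℕ) :
    (progression c s 1 C.length).Perm C := by
  have := h.map_perm (I := (List.range C.length).map fun j => s + 1 * j) ?_ (by simp)
  · simpa [progression, List.map_map, Function.comp_def] using this
  · rw [List.map_map]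
    refine List.Nodup.map_on (fun i hi j hj hij => ?_) List.nodup_range
    rw [List.mem_range] at hi hj
    have : s + 1 * i ≡ s + 1 * j [MOD C.length] := hij
    rw [one_mul, one_mul] at this
    exact (Nat.ModEq.add_left_cancel' s this).eq_of_lt_of_lt hi hj

theorem Enumerates.progression_two_perm_of_odd {c : ℕ → α} {C : List α} (h : Enumerates c C)
    (hodd : Odd C.length) (s : ℕ) : (progression c s 2 C.length).Perm C := by
  have := h.map_perm (I := (List.range C.length).map fun j => s + 2 * j) ?_ (by simp)
  · simpa [progression, List.map_map, Function.comp_def] using this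
  · rw [List.map_map]
    refine List.Nodup.map_on (fun i hi j hj hij => ?_) List.nodup_range
    rw [List.mem_range] at hi hj
    have : s + 2 * i ≡ s + 2 * j [MOD C.length] := hij
    refine (Nat.ModEq.cancel_left_of_coprime ?_
      (Nat.ModEq.add_left_cancel' s this)).eq_of_lt_of_lt hi hj
    exact Nat.coprime_two_right.2 hodd

theorem Enumerates.progression_two_append_perm {c : ℕ → α} {C : List α} (h : Enumerates c C)
    {k s t : ℕ} (hk : C.length = 2 * k) (hst : s % 2 ≠ t % 2) :
    (progression c s 2 k ++ progression c t 2 k).Perm C := by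
  have := h.map_perm (I := ((List.range k).map fun j => s + 2 * j) ++
    (List.range k).map fun j => t + 2 * j) ?_ (by simp [hk, two_mul])
  · simpa [progression, List.map_map, Function.comp_def] using this
  · have hnd : ∀ s, (((List.range k).map fun j => s + 2 * j).map (· % C.length)).Nodup := by
      intro s
      rw [List.map_map]
      refine List.Nodup.map_on (fun i hi j hj hij => ?_) List.nodup_range
      rw [List.mem_range] at hi hj
      have : s + 2 * i ≡ s + 2 * j [MOD C.length] := hij
      have := (Nat.ModEq.add_left_cancel' s this).eq_of_lt_of_lt (by omega) (by omega)
      omega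
    rw [List.map_append, List.nodup_append]
    refine ⟨hnd s, hnd t, ?_⟩
    intro x hx y hy hxy
    simp only [List.mem_map] at hx hy
    obtain ⟨_, ⟨i, -, rfl⟩, hx⟩ := hx
    obtain ⟨_, ⟨j, -, rfl⟩, hy⟩ := hy
    -- The length is even, so residues modulo it keep their parity.
    have h₁ : (s + 2 * i) % 2 = (t + 2 * j) % 2 := by
      rw [← Nat.mod_mul_right_mod _ 2 k, ← Nat.mod_mul_right_mod (t + 2 * j) 2 k, ← hk, hx, hy, hxy]
    omega

theorem Enumerates.exists_add_eq {c : ℕ → α} {C : List α} (h : Enumerates c C)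
    (hC : 0 < C.length) (i j : ℕ) :
    ∃ k < C.length, ∀ t, c (i + k + t) = c (j + t) := by
  -- This is `j - i` modulo the length, written without subtracting `i`.
  refine ⟨(j + (C.length - 1) * i) % C.length, Nat.mod_lt _ hC, fun t => h.congr ?_⟩
  refine Nat.ModEq.add_right t ?_
  have : i + (j + (C.length - 1) * i) = j + C.length * i := by
    obtain ⟨p, hp⟩ := Nat.exists_eq_add_of_lt hC
    rw [hp]
    simp
    ring
  refine ((Nat.mod_modEq _ _).add_left i).trans ?_
  rw [this]
  simp [Nat.ModEq]

theorem Enumerates.rel_succ {c : ℕ → α} {C : List α} (h : Enumerates c C) (hC : 0 < C.length)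
    (hR : IsClosedChain R C) (i : ℕ) : R (c i) (c (i + 1)) := by
  have hlt := Nat.mod_lt i hC
  have hi : i + 1 ≡ i % C.length + 1 [MOD C.length] := ((Nat.mod_modEq _ _).add_right 1).symm
  rw [h.congr hi, ← h.2 i]
  have hget : ∀ j (hj : j < C.length), C[j] = c j := by
    intro j hj
    have := h.1
    have h2 : C[j]? = (progression c 0 1 C.length)[j]? := by rw [← this]
    simpa [progression, hj] using h2
  rcases Nat.lt_or_ge (i % C.length + 1) C.length with h' | h'
  · rw [← hget _ hlt, ← hget _ h']
    exact hR.1.getElem _ h'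
  · have h₁ : i % C.length + 1 = C.length := by omega
    have h₂ : c (i % C.length + 1) = c 0 := h.congr (by simp [h₁, Nat.ModEq])
    rw [h₂]
    refine hR.2 _ ?_ _ ?_
    · rw [h.1, head?_progression _ _ _ hC]; rfl
    · have : (progression c 0 1 C.length).getLast? = some (c (i % C.length)) := by
        conv_lhs => rw [← h₁]
        rw [getLast?_progression, zero_add, one_mul]
      rw [← h.1] at this
      exact this

/-! ### Enlarging a closed chain -/

theorem isClosedChain_insert {c : ℕ → α} {p : ℕ} (hc : ∀ i, R (c i) (c (i + 1)))
    (hp : ∀ i, c (i + p) = c i) {i : ℕ} (h0 : 0 < p) {w : List α} (hw : w ≠ []) (hwc : w.IsChain R)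
    (h₁ : ∀ x ∈ w.head?, R (c i) x) (h₂ : ∀ x ∈ w.getLast?, R x (c (i + 1))) :
    IsClosedChain R (progression c (i + 1) 1 p ++ w) := by
  obtain ⟨q, rfl⟩ := Nat.exists_eq_add_of_lt h0
  simp only [zero_add] at *
  have hlast : c (i + 1 + 1 * q) = c i := by rw [← hp i]; congr 1; ring
  constructor
  · rw [List.isChain_append]
    refine ⟨isChain_progression hc _ _, hwc, fun x hx y hy => ?_⟩
    rw [getLast?_progression, hlast] at hx
    obtain rfl : c i = x := by simpa using hx
    exact h₁ y hy
  · intro x hx y hy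
    rw [List.head?_append, head?_progression _ _ _ (Nat.succ_pos q)] at hx
    obtain rfl : c (i + 1) = x := by simpa using hx
    rw [List.getLast?_append_of_ne_nil _ hw] at hy
    exact h₂ y hy

/-- The edges leaving `c i` and `c (i + k)` give way to the chord between their successors and the
detour `w`. The arc from `c (i + 1)` to `c (i + k)` is run backwards. -/
theorem isClosedChain_exchange_succ {c : ℕ → α} {p : ℕ} (hc : ∀ i, R (c i) (c (i + 1)))
    (hp : ∀ i, c (i + p) = c i) (hR : ∀ {x y}, R x y → R y x) {i k l : ℕ}
    (hk : 0 < k) (hl : 0 < l) (hkl : k + l = p) {w : List α} (hw : w ≠ []) (hwc : w.IsChain R)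
    (h₁ : ∀ x ∈ w.head?, R (c i) x) (h₂ : ∀ x ∈ w.getLast?, R x (c (i + k)))
    (h : R (c (i + 1)) (c (i + k + 1))) :
    IsClosedChain R ((progression c (i + 1) 1 k).reverse ++ progression c (i + k + 1) 1 l ++ w) := by
  obtain ⟨k, rfl⟩ := Nat.exists_eq_add_of_lt hk
  obtain ⟨l, rfl⟩ := Nat.exists_eq_add_of_lt hl
  simp only [zero_add] at *
  have hlast : c (i + (k + 1) + 1 + 1 * l) = c i := by rw [← hp i]; congr 1; omega
  have hlast' : c (i + 1 + 1 * k) = c (i + (k + 1)) := by congr 1; omega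
  constructor
  · rw [List.isChain_append, List.isChain_append]
    refine ⟨⟨isChain_reverse_of_symm hR (isChain_progression hc _ _), isChain_progression hc _ _,
      fun x hx y hy => ?_⟩, hwc, fun x hx y hy => ?_⟩
    · rw [List.getLast?_reverse, head?_progression _ _ _ (Nat.succ_pos k)] at hx
      rw [head?_progression _ _ _ (Nat.succ_pos l)] at hy
      obtain rfl : c (i + 1) = x := by simpa using hx
      obtain rfl : c (i + (k + 1) + 1) = y := by simpa using hy
      exact h
    · rw [List.getLast?_append, getLast?_progression, hlast] at hx
      obtain rfl : c i = x := by simpa using hx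
      exact h₁ y hy
  · intro x hx y hy
    rw [List.append_assoc, List.head?_append, List.head?_reverse, getLast?_progression, hlast'] at hx
    obtain rfl : c (i + (k + 1)) = x := by simpa using hx
    rw [List.getLast?_append_of_ne_nil _ hw] at hy
    exact h₂ y hy

/-- The mirror image: the chord joins predecessors, and `w` joins `c (i + k + 1)` to `c (i + 1)`. -/
theorem isClosedChain_exchange_pred {c : ℕ → α} {p : ℕ} (hc : ∀ i, R (c i) (c (i + 1)))
    (hp : ∀ i, c (i + p) = c i) (hR : ∀ {x y}, R x y → R y x) {i k l : ℕ}
    (hk : 0 < k) (hl : 0 < l) (hkl : k + l = p) {w : List α} (hw : w ≠ []) (hwc : w.IsChain R)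
    (h₁ : ∀ x ∈ w.head?, R (c (i + k + 1)) x) (h₂ : ∀ x ∈ w.getLast?, R x (c (i + 1)))
    (h : R (c (i + k)) (c i)) :
    IsClosedChain R (progression c (i + 1) 1 k ++ (progression c (i + k + 1) 1 l).reverse ++ w) := by
  obtain ⟨k, rfl⟩ := Nat.exists_eq_add_of_lt hk
  obtain ⟨l, rfl⟩ := Nat.exists_eq_add_of_lt hl
  simp only [zero_add] at *
  have hlast : c (i + (k + 1) + 1 + 1 * l) = c i := by rw [← hp i]; congr 1; omega
  have hlast' : c (i + 1 + 1 * k) = c (i + (k + 1)) := by congr 1; omega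
  constructor
  · rw [List.isChain_append, List.isChain_append]
    refine ⟨⟨isChain_progression hc _ _, isChain_reverse_of_symm hR (isChain_progression hc _ _),
      fun x hx y hy => ?_⟩, hwc, fun x hx y hy => ?_⟩
    · rw [getLast?_progression, hlast'] at hx
      rw [List.head?_reverse, getLast?_progression, hlast] at hy
      obtain rfl : c (i + (k + 1)) = x := by simpa using hx
      obtain rfl : c i = y := by simpa using hy
      exact h
    · rw [List.getLast?_append, List.getLast?_reverse,
        head?_progression _ _ _ (Nat.succ_pos l)] at hx
      obtain rfl : c (i + (k + 1) + 1) = x := by simpa using hx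
      exact h₁ y hy
  · intro x hx y hy
    rw [List.append_assoc, List.head?_append, head?_progression _ _ _ (Nat.succ_pos k)] at hx
    obtain rfl : c (i + 1) = x := by simpa using hx
    rw [List.getLast?_append_of_ne_nil _ hw] at hy
    exact h₂ y hy

theorem progression_one_append (c : ℕ → α) (s k l : ℕ) :
    progression c s 1 k ++ progression c (s + k) 1 l = progression c s 1 (k + l) := by
  simp [progression, List.range_add, Function.comp_def, add_assoc]

end Progression

/-! ### Partition of a two-coloured complete graph into two monochromatic cycles. -/

section Partition

variable {α : Type*} {R B : α → α → Prop}

/-- A cyclic list such that any two elements at distance two are `B`-related, unless the element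
between them satisfies `u`, splits into a `B`-chain and a `B`-cycle, if the successors of elements
with `u` are pairwise `B`-related, and so are the predecessors. -/
theorem Enumerates.exists_chain_append_closedChain {c : ℕ → α} {C : List α} (h : Enumerates c C)
    (hC : 0 < C.length) (hB : ∀ {x y}, B x y → B y x) {u : α → Prop}
    (h₂ : ∀ i, ¬u (c (i + 1)) → B (c i) (c (i + 2)))
    (hu : ∀ i, u (c i) → ¬u (c (i + 1)))
    (hsucc : ∀ i j, u (c i) → u (c j) → B (c (i + 1)) (c (j + 1)))
    (hpred : ∀ i j, u (c (i + 1)) → u (c (j + 1)) → B (c i) (c j)) :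
    ∃ l₁ l₂, (l₁ ++ l₂).Perm C ∧ l₁ ≠ [] ∧ l₁.IsChain B ∧ (∀ x ∈ l₁.head?, ¬u x) ∧
      (∀ x ∈ l₁.getLast?, ¬u x) ∧ IsClosedChain B l₂ := by
  obtain ⟨q, hq⟩ := Nat.exists_eq_add_of_lt hC
  rw [zero_add] at hq
  have hper : ∀ i j, i = j + C.length → c i = c j := fun i j hij => by
    rw [hij, h.add_length]
  by_cases hall : ∀ i, ¬u (c i)
  · have hch : ∀ i, B (c i) (c (i + 2)) := fun i => h₂ i (hall _)
    have hnot : ∀ s k, ∀ x ∈ progression c s 2 k, ¬u x := by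
      intro s k x hx
      obtain ⟨j, -, rfl⟩ := List.mem_map.1 hx
      exact hall _
    have hne : ∀ s k, 0 < k → progression c s 2 k ≠ [] := by
      intro s k hk h0
      have := length_progression c s 2 k
      simp [h0] at this
      omega
    rcases Nat.even_or_odd C.length with heven | hodd
    · obtain ⟨k, hk⟩ := heven.exists_two_nsmul
      rw [smul_eq_mul] at hk
      obtain ⟨m, rfl⟩ := Nat.exists_eq_add_of_lt (show 0 < k by omega)
      refine ⟨progression c 0 2 (0 + m + 1), progression c 1 2 (0 + m + 1),
        h.progression_two_append_perm hk (by simp), hne _ _ (by omega),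
        isChain_progression hch _ _, fun x hx => hnot _ _ _ (List.mem_of_mem_head? hx),
        fun x hx => hnot _ _ _ (List.mem_of_mem_getLast? hx),
        isChain_progression hch _ _, fun x hx y hy => ?_⟩
      rw [head?_progression _ _ _ (by omega)] at hx
      rw [getLast?_progression] at hy
      obtain rfl : c 1 = x := by simpa using hx
      obtain rfl : c (1 + 2 * (0 + m)) = y := by simpa using hy
      rw [← hper (1 + 2 * (0 + m) + 2) 1 (by omega)]
      exact hch _
    · exact ⟨progression c 0 2 C.length, [], by simpa using h.progression_two_perm_of_odd hodd 0,
        hne _ _ hC, isChain_progression hch _ _,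
        fun x hx => hnot _ _ _ (List.mem_of_mem_head? hx),
        fun x hx => hnot _ _ _ (List.mem_of_mem_getLast? hx), .nil⟩
  · push Not at hall
    obtain ⟨a, ha⟩ := hall
    -- `M` and `P` hold the predecessors and successors of elements with `u`; a step of two can fail
    -- to be blue only from `M` to `P`, across such an element.
    let M : α → Prop := fun x => ∃ i, u (c (i + 1)) ∧ c i = x
    let P : α → Prop := fun x => ∃ i, u (c i) ∧ c (i + 1) = x
    have hMB : ∀ x y, M x → M y → B x y := by
      rintro _ _ ⟨i, hi, rfl⟩ ⟨j, hj, rfl⟩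
      exact hpred i j hi hj
    have hPB : ∀ x y, P x → P y → B x y := by
      rintro _ _ ⟨i, hi, rfl⟩ ⟨j, hj, rfl⟩
      exact hsucc i j hi hj
    have hMu : ∀ x, M x → ¬u x := by
      rintro _ ⟨i, hi, rfl⟩ hi'
      exact hu i hi' hi
    have hPu : ∀ x, P x → ¬u x := by
      rintro _ ⟨i, hi, rfl⟩
      exact hu i hi
    have hMlast : ∀ a j, u (c a) → a + C.length = j + 1 → M (c j) := by
      intro a j ha hj
      exact ⟨j, by rwa [← hj, h.add_length], rfl⟩
    have hstep : ∀ i, B (c i) (c (i + 2)) ∨ M (c i) ∧ P (c (i + 2)) := by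
      intro i
      by_cases hi : u (c (i + 1))
      · exact .inr ⟨⟨i, hi, rfl⟩, i + 1, hi, rfl⟩
      · exact .inl (h₂ i hi)
    have hlink : ∀ s : List α, s.IsChain (fun x y => B x y ∨ M x ∧ P y) →
        (∃ x ∈ s.head?, P x) → (∀ z ∈ s.getLast?, M z) →
        ∃ l : List α, l.Perm s ∧ l ≠ [] ∧ l.IsChain B ∧ (∀ x ∈ l.head?, ¬u x) ∧
          ∀ x ∈ l.getLast?, ¬u x := by
      intro s hs ⟨x, hx, hPx⟩ hlast
      obtain ⟨s, rfl⟩ := List.head?_eq_some_iff.1 hx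
      obtain ⟨l, hl, hc, hll⟩ := (exists_chain_perm_of_breaks hB hMB hPB s x hs hlast).1
      refine ⟨x :: l, hl, by simp, hc, ?_, fun z hz => (hll z hz).elim (hMu z) (hPu z)⟩
      intro y hy
      obtain rfl : x = y := by simpa using hy
      exact hPu x hPx
    rcases Nat.even_or_odd C.length with heven | hodd
    · obtain ⟨k, hk⟩ := heven.exists_two_nsmul
      rw [smul_eq_mul] at hk
      obtain ⟨m, rfl⟩ := Nat.exists_eq_add_of_lt (show 0 < k by omega)
      -- Steps of two now stay in one parity class. If `u` occurs in both, the class of `a + 1` ends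
      -- just before `a`, and the class of `b + 1` follows across one more break. Otherwise the
      -- class of `a` has no break and is a blue cycle.
      by_cases hb : ∃ b, u (c b) ∧ b % 2 ≠ a % 2
      · obtain ⟨b, hb, hab⟩ := hb
        have hs₁ : (progression c (a + 1) 2 (0 + m + 1) ++
            progression c (b + 1) 2 (0 + m + 1)).IsChain fun x y => B x y ∨ M x ∧ P y := by
          rw [List.isChain_append]
          refine ⟨isChain_progression hstep _ _, isChain_progression hstep _ _, ?_⟩
          intro x hx y hy
          rw [getLast?_progression] at hx
          rw [head?_progression _ _ _ (by omega)] at hy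
          obtain rfl : c (a + 1 + 2 * (0 + m)) = x := by simpa using hx
          obtain rfl : c (b + 1) = y := by simpa using hy
          exact .inr ⟨hMlast a _ ha (by omega), b, hb, rfl⟩
        have hs₂ : ∃ x ∈ (progression c (a + 1) 2 (0 + m + 1) ++
            progression c (b + 1) 2 (0 + m + 1)).head?, P x :=
          ⟨c (a + 1), by rw [List.head?_append, head?_progression _ _ _ (by omega)]; rfl,
            a, ha, rfl⟩
        have hs₃ : ∀ z ∈ (progression c (a + 1) 2 (0 + m + 1) ++
            progression c (b + 1) 2 (0 + m + 1)).getLast?, M z := by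
          intro z hz
          rw [List.getLast?_append, getLast?_progression] at hz
          obtain rfl : c (b + 1 + 2 * (0 + m)) = z := by simpa using hz
          exact hMlast b _ hb (by omega)
        obtain ⟨l, hl, h1, h2, h3, h4⟩ := hlink _ hs₁ hs₂ hs₃
        refine ⟨l, [], ?_, h1, h2, h3, h4, .nil⟩
        rw [List.append_nil]
        exact hl.trans (h.progression_two_append_perm hk (by omega))
      · push Not at hb
        have hs₁ : (progression c (a + 1) 2 (0 + m + 1)).IsChain fun x y => B x y ∨ M x ∧ P y :=
          isChain_progression hstep _ _
        have hs₂ : ∃ x ∈ (progression c (a + 1) 2 (0 + m + 1)).head?, P x :=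
          ⟨c (a + 1), by rw [head?_progression _ _ _ (by omega)]; rfl, a, ha, rfl⟩
        have hs₃ : ∀ z ∈ (progression c (a + 1) 2 (0 + m + 1)).getLast?, M z := by
          intro z hz
          rw [getLast?_progression] at hz
          obtain rfl : c (a + 1 + 2 * (0 + m)) = z := by simpa using hz
          exact hMlast a _ ha (by omega)
        obtain ⟨l, hl, h1, h2, h3, h4⟩ := hlink _ hs₁ hs₂ hs₃
        have hch : ∀ j, B (c (a + 2 * j)) (c (a + 2 * (j + 1))) := by
          intro j
          refine h₂ _ fun hj => ?_
          have := hb _ hj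
          omega
        have heq : progression c a 2 (0 + m + 1) =
            progression (fun j => c (a + 2 * j)) 0 1 (0 + m + 1) := by
          simp [progression]
        refine ⟨l, progression c a 2 (0 + m + 1), ?_, h1, h2, h3, h4, ?_, ?_⟩
        · exact (hl.append_right _).trans (h.progression_two_append_perm hk (by omega))
        · rw [heq]
          exact isChain_progression hch _ _
        · intro x hx y hy
          rw [head?_progression _ _ _ (by omega)] at hx
          rw [getLast?_progression] at hy
          obtain rfl : c a = x := by simpa using hx
          obtain rfl : c (a + 2 * (0 + m)) = y := by simpa using hy
          rw [← hper (a + 2 * (0 + m + 1)) a (by omega)]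
          exact hch _
    · have hs₁ : (progression c (a + 1) 2 C.length).IsChain fun x y => B x y ∨ M x ∧ P y :=
        isChain_progression hstep _ _
      have hs₂ : ∃ x ∈ (progression c (a + 1) 2 C.length).head?, P x :=
        ⟨c (a + 1), by rw [head?_progression _ _ _ hC]; rfl, a, ha, rfl⟩
      have hs₃ : ∀ z ∈ (progression c (a + 1) 2 C.length).getLast?, M z := by
        intro z hz
        rw [hq, getLast?_progression] at hz
        obtain rfl : c (a + 1 + 2 * q) = z := by simpa using hz
        -- The length is `q + 1`, so `a + q` indexes the predecessor of `c a`.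
        rw [hper (a + 1 + 2 * q) (a + q) (by omega)]
        exact hMlast a _ ha (by omega)
      obtain ⟨l, hl, h1, h2, h3, h4⟩ := hlink _ hs₁ hs₂ hs₃
      refine ⟨l, [], ?_, h1, h2, h3, h4, .nil⟩
      rw [List.append_nil]
      exact hl.trans (h.progression_two_perm_of_odd hodd _)

theorem IsTotalPair.exists_two_closedChains (h : IsTotalPair R B) (vs : List α) :
    ∃ l m : List α, (l ++ m).Perm vs ∧ (IsClosedChain R l ∨ IsClosedChain B l) ∧
      (IsClosedChain R m ∨ IsClosedChain B m) := by
  by_contra hno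
  obtain ⟨C, m, ⟨hp, hC, hm⟩, hmax⟩ := exists_pair_length_maximal
    (Q := fun l m => (l ++ m).Perm vs ∧ IsClosedChain R l ∧ m.IsChain B) (N := vs.length)
    (by rintro l m ⟨hp, -⟩; have := hp.length_eq; simp at this; omega)
    (h.exists_closedChain_partition vs)
  have hmB : ¬IsClosedChain B m := fun h => hno ⟨C, m, hp, .inl hC, .inr h⟩
  obtain ⟨x, hx, y, hy, hyx⟩ : ∃ x ∈ m.head?, ∃ y ∈ m.getLast?, ¬B y x := by
    by_contra hcon
    push Not at hcon
    exact hmB ⟨hm, hcon⟩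
  have hRxy : R y x := (h.total y x).resolve_right hyx
  obtain ⟨m₁, rfl⟩ := List.head?_eq_some_iff.1 hx
  obtain ⟨m₂, rfl⟩ : ∃ m₂, m₁ = m₂ ++ [y] := by
    rcases List.eq_nil_or_concat m₁ with rfl | ⟨m₂, z, rfl⟩
    · obtain rfl : x = y := by simpa using hy
      exact absurd (h.refl_right x) hyx
    · obtain rfl : z = y := by simpa [List.getLast?_cons, List.getLast?_append] using hy
      exact ⟨m₂, by simp⟩
  have hCne : C ≠ [] := by
    rintro rfl
    have := hmax [x] (m₂ ++ [y]) ⟨by simpa using hp, .singleton x (h.refl_left x), hm.tail⟩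
    simp at this
  have hC0 : 0 < C.length := List.length_pos_iff.2 hCne
  obtain ⟨c, hc⟩ := exists_enumerates hCne
  have hcR := hc.rel_succ hC0 hC
  have hper := hc.add_length
  have hB1 : (x :: m₂).IsChain B := by
    have : (x :: m₂) ++ [y] = x :: (m₂ ++ [y]) := rfl
    rw [← this] at hm
    exact hm.left_of_append
  set u : α → Prop := fun z => R x z ∨ R y z with hu_def
  /- the end vertices of the chain that join two vertices with `u` -/
  have hw : ∀ z z', u z → u z' → ∃ w m', w ≠ [] ∧ w.IsChain R ∧ (∀ t ∈ w.head?, R z t) ∧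
      (∀ t ∈ w.getLast?, R t z') ∧ m'.IsChain B ∧ (w ++ m').Perm (x :: (m₂ ++ [y])) := by
    have hxw : [x] ++ (m₂ ++ [y]) = x :: (m₂ ++ [y]) := rfl
    have hyw : ([y] ++ (x :: m₂)).Perm (x :: (m₂ ++ [y])) := List.perm_append_comm
    have hm₂ : m₂.IsChain B := hB1.tail
    have hxyw : ([x, y] ++ m₂).Perm (x :: (m₂ ++ [y])) :=
      List.Perm.cons x (List.perm_append_comm (l₁ := [y]))
    have hyxw : ([y, x] ++ m₂).Perm (x :: (m₂ ++ [y])) := (List.Perm.swap _ _ _).trans hxyw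
    rintro z z' (hz | hz) (hz' | hz')
    · exact ⟨[x], _, by simp, by simp, by simpa using h.symm_left hz, by simpa using hz', hm.tail,
        .of_eq hxw⟩
    · exact ⟨[x, y], _, by simp, by simpa using h.symm_left hRxy, by simpa using h.symm_left hz,
        by simpa using hz', hm₂, hxyw⟩
    · exact ⟨[y, x], _, by simp, by simpa using hRxy, by simpa using h.symm_left hz,
        by simpa using hz', hm₂, hyxw⟩
    · exact ⟨[y], _, by simp, by simp, by simpa using h.symm_left hz, by simpa using hz', hB1,
        hyw⟩
  have hlarger : ∀ D w m' : List α, D.Perm C → w ≠ [] → m'.IsChain B →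
      (w ++ m').Perm (x :: (m₂ ++ [y])) → ¬IsClosedChain R (D ++ w) := by
    intro D w m' hD hw hm' hp' hcl
    have := hmax (D ++ w) m' ⟨?_, hcl, hm'⟩
    · have h1 := hD.length_eq
      have h2 := List.length_pos_iff.2 hw
      simp at this
      omega
    · rw [List.append_assoc]
      exact (hD.append hp').trans hp
  have hu : ∀ i, u (c i) → ¬u (c (i + 1)) := by
    intro i h1 h2
    obtain ⟨w, m', hw, hwc, hw1, hw2, hm', hp'⟩ := hw _ _ h1 h2
    exact hlarger _ w m' (hc.progression_one_perm (i + 1)) hw hm' hp'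
      (isClosedChain_insert hcR hper hC0 hw hwc hw1 hw2)
  have hsplit : ∀ i k l, k + l = C.length →
      (progression c (i + 1) 1 k ++ progression c (i + k + 1) 1 l).Perm C := by
    intro i k l hkl
    have := progression_one_append c (i + 1) k l
    rw [hkl, add_right_comm] at this
    rw [this]
    exact hc.progression_one_perm _
  have hsucc : ∀ i j, u (c i) → u (c j) → B (c (i + 1)) (c (j + 1)) := by
    intro i j hi hj
    obtain ⟨k, hk, hkj⟩ := hc.exists_add_eq hC0 i j
    rw [← hkj 1]
    rcases Nat.eq_zero_or_pos k with rfl | hk0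
    · exact h.refl_right _
    refine (h.total _ _).resolve_left fun hR => ?_
    obtain ⟨w, m', hw, hwc, hw1, hw2, hm', hp'⟩ := hw _ _ hi hj
    refine hlarger _ w m' ?_ hw hm' hp' (isClosedChain_exchange_succ hcR hper h.symm_left
      (l := C.length - k) hk0 (by omega) (by omega) hw hwc hw1 ?_ hR)
    · exact ((List.reverse_perm _).append_right _).trans (hsplit _ _ _ (by omega))
    · rwa [← add_zero (i + k), hkj 0]
  have hpred : ∀ i j, u (c (i + 1)) → u (c (j + 1)) → B (c i) (c j) := by
    intro i j hi hj
    obtain ⟨k, hk, hkj⟩ := hc.exists_add_eq hC0 i j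
    rw [← add_zero j, ← hkj 0, add_zero]
    rcases Nat.eq_zero_or_pos k with rfl | hk0
    · exact h.refl_right _
    refine (h.total _ _).resolve_left fun hR => ?_
    obtain ⟨w, m', hw, hwc, hw1, hw2, hm', hp'⟩ := hw _ _ hj hi
    refine hlarger _ w m' ?_ hw hm' hp' (isClosedChain_exchange_pred hcR hper h.symm_left
      (l := C.length - k) hk0 (by omega) (by omega) hw hwc ?_ hw2 (h.symm_left hR))
    · exact ((List.reverse_perm _).append_left _).trans (hsplit _ _ _ (by omega))
    · rwa [hkj 1]
  have hxB : ∀ z, ¬u z → B z x := fun z hz =>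
    h.symm_right ((h.total x z).resolve_left fun h => hz (.inl h))
  have hyB : ∀ z, ¬u z → B y z := fun z hz => (h.total y z).resolve_left fun h => hz (.inr h)
  have hclose : ∀ l : List α, l ≠ [] → l.IsChain B → (∀ z ∈ l.head?, ¬u z) →
      (∀ z ∈ l.getLast?, ¬u z) → IsClosedChain B (l ++ x :: (m₂ ++ [y])) := by
    intro l hl hlc h1 h2
    constructor
    · rw [List.isChain_append]
      refine ⟨hlc, hm, fun a ha b hb => ?_⟩
      obtain rfl : x = b := by simpa using hb
      exact hxB _ (h2 a ha)
    · intro a ha b hb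
      rw [List.head?_append_of_ne_nil _ hl] at ha
      rw [List.getLast?_append_of_ne_nil _ (by simp)] at hb
      obtain rfl : y = b := by rw [hy] at hb; simpa using hb
      exact hyB _ (h1 a ha)
  have h₂ : ∀ i, ¬u (c (i + 1)) → B (c i) (c (i + 2)) := by
    intro i hi
    -- A red chord closes `C` without `c (i + 1)`, and that vertex, being blue to `x` and `y`,
    -- closes the blue chain.
    refine (h.total _ _).resolve_left fun hR => hno ?_
    obtain ⟨q, hq⟩ := Nat.exists_eq_add_of_lt hC0
    rw [zero_add] at hq
    refine ⟨progression c (i + 1 + 1) 1 q, [c (i + 1)] ++ x :: (m₂ ++ [y]), ?_, .inl ⟨?_, ?_⟩,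
      .inr (hclose _ (by simp) (by simp) (by simpa using hi) (by simpa using hi))⟩
    · rw [← List.append_assoc]
      refine (List.Perm.append_right _ ?_).trans hp
      refine List.perm_append_comm.trans ?_
      have := hsplit i 1 q (by omega)
      simpa [progression] using this
    · exact isChain_progression hcR _ _
    · intro a ha b hb
      rcases q with _ | q
      · simp [progression] at ha
      · rw [head?_progression _ _ _ (Nat.succ_pos q)] at ha
        rw [getLast?_progression] at hb
        obtain rfl : c (i + 1 + 1) = a := by simpa using ha
        obtain rfl : c (i + 1 + 1 + 1 * q) = b := by simpa using hb
        have : i + 1 + 1 + 1 * q = i + C.length := by omega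
        rw [this, hper]
        exact hR
  obtain ⟨l₁, l₂, hl, hne, hl₁, hh, hlast, hl₂⟩ :=
    hc.exists_chain_append_closedChain (B := B) (u := u) hC0 h.symm_right h₂ hu hsucc hpred
  -- Both cycles are blue here.
  refine hno ⟨l₂, l₁ ++ x :: (m₂ ++ [y]), ?_, .inr hl₂, .inr (hclose l₁ hne hl₁ hh hlast)⟩
  rw [← List.append_assoc]
  exact ((List.perm_append_comm.trans hl).append_right _).trans hp

end Partition

/-! ### From closed chains to monochromatic cycles, and the upper bound. -/

section Walks

variable {V : Type*} {G : SimpleGraph V} {r k : ℕ}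

/-- The colour `i` belongs to the colour set of `e`, if `e` is an edge at all. -/
def HasColour (φ : Colouring G r k) (i : Fin r) (e : Sym2 V) : Prop :=
  ∀ he : e ∈ G.edgeSet, i ∈ (φ ⟨e, he⟩ : {c : Finset (Fin r) // c.card = k}).1

theorem isMonochromatic_iff {φ : Colouring G r k} {u v : V} {p : G.Walk u v} :
    IsMonochromatic φ p ↔ ∃ i, ∀ e ∈ p.edges, HasColour φ i e :=
  ⟨fun ⟨i, h⟩ => ⟨i, fun e he _ => h e he⟩, fun ⟨i, h⟩ => ⟨i, fun e he => h e he _⟩⟩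

theorem IsMonoCycleSet.isMonoPathSet {φ : Colouring G r k} {S : Finset V}
    (h : IsMonoCycleSet φ S) : IsMonoPathSet φ S := by
  rcases h with ⟨u, v, p, hp, -, hm, hS⟩ | ⟨u, p, hp, hm, hS⟩
  · exact ⟨u, v, p, hp, hm, hS⟩
  · obtain ⟨i, hi⟩ := isMonochromatic_iff.1 hm
    refine ⟨_, u, p.tail, hp.isPath_tail, isMonochromatic_iff.2 ⟨i, fun e he => hi e ?_⟩, ?_⟩
    · cases p with
      | nil => simp at he
      | cons h q =>
        rw [SimpleGraph.Walk.edges_cons]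
        exact List.mem_cons_of_mem _ (by simpa using he)
    · intro x
      rw [hS, SimpleGraph.Walk.support_tail_of_not_nil _ hp.not_nil]
      refine ⟨fun hx => ?_, List.mem_of_mem_tail⟩
      rw [← SimpleGraph.Walk.cons_tail_support, List.mem_cons] at hx
      rcases hx with rfl | hx
      · exact SimpleGraph.Walk.end_mem_tail_support hp.not_nil
      · exact hx

theorem CyclesSuffice.pathsSuffice {m : ℕ} (h : CyclesSuffice r k m) : PathsSuffice r k m :=
  fun n φ => (h n φ).imp fun _ hP => ⟨hP.1, fun S hS => (hP.2 S hS).isMonoPathSet⟩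

theorem exists_walk_of_isChain (φ : Colouring (⊤ : SimpleGraph V) r k) (i : Fin r) (l : List V)
    (a : V) (hnd : (a :: l).Nodup) (hl : (a :: l).IsChain fun x y => HasColour φ i s(x, y)) :
    ∃ (v : V) (p : (⊤ : SimpleGraph V).Walk a v), p.support = a :: l ∧
      (a :: l).getLast? = some v ∧ ∀ e ∈ p.edges, HasColour φ i e := by
  induction l generalizing a with
  | nil => exact ⟨a, .nil, by simp⟩
  | cons b l ih =>
    rw [List.isChain_cons_cons] at hl
    obtain ⟨v, p, hp, hv, hc⟩ := ih b (List.nodup_cons.1 hnd).2 hl.2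
    have hab : (⊤ : SimpleGraph V).Adj a b := by
      rw [SimpleGraph.top_adj]
      rintro rfl
      simp at hnd
    refine ⟨v, .cons hab p, by simp [hp], by simpa using hv, fun e he => ?_⟩
    rw [SimpleGraph.Walk.edges_cons, List.mem_cons] at he
    rcases he with rfl | he
    · exact hl.1
    · exact hc e he

theorem IsClosedChain.isMonoCycleSet [DecidableEq V] {φ : Colouring (⊤ : SimpleGraph V) r k}
    {i : Fin r} {l : List V} (hne : l ≠ []) (hnd : l.Nodup)
    (hl : IsClosedChain (fun x y => HasColour φ i s(x, y)) l) :
    IsMonoCycleSet φ l.toFinset := by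
  obtain ⟨a, l, rfl⟩ := List.exists_cons_of_ne_nil hne
  obtain ⟨v, p, hp, hv, hc⟩ := exists_walk_of_isChain φ i l a hnd hl.1
  have hpath : p.IsPath := by rwa [SimpleGraph.Walk.isPath_def, hp]
  have hlen : p.length = l.length := by
    have := p.length_support
    rw [hp] at this
    simpa using this.symm
  have hmem : ∀ x, x ∈ (a :: l).toFinset ↔ x ∈ p.support := by simp [hp]
  rcases Nat.lt_or_ge 1 p.length with h1 | h1
  · have hva : (⊤ : SimpleGraph V).Adj v a := by
      rw [SimpleGraph.top_adj]
      rintro rfl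
      have := (SimpleGraph.Walk.isPath_iff_nil.1 hpath).length_eq_zero
      omega
    refine .inr ⟨v, .cons hva p, ?_, isMonochromatic_iff.2 ⟨i, fun e he => ?_⟩, fun x => ?_⟩
    · rw [SimpleGraph.Walk.isCycle_iff_isPath_tail_and_le_length]
      simp only [SimpleGraph.Walk.length_cons]
      exact ⟨by simpa using hpath, by omega⟩
    · rw [SimpleGraph.Walk.edges_cons, List.mem_cons] at he
      rcases he with rfl | he
      · exact hl.2 a (by simp) v (by rw [hv]; rfl)
      · exact hc e he
    · rw [hmem, SimpleGraph.Walk.support_cons, List.mem_cons]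
      refine ⟨.inr, ?_⟩
      rintro (rfl | hx)
      · exact p.end_mem_support
      · exact hx
  · exact .inl ⟨a, v, p, hpath, h1, isMonochromatic_iff.2 ⟨i, hc⟩, hmem⟩

/-- A set avoiding both colours has at most `r - 2` elements. -/
theorem hasColour_or_of_ne (φ : Colouring G r (r - 1)) {i j : Fin r} (hij : i ≠ j) (e : Sym2 V) :
    HasColour φ i e ∨ HasColour φ j e := by
  by_contra hcon
  push Not at hcon
  obtain ⟨h1, h2⟩ := hcon
  unfold HasColour at h1 h2
  push Not at h1 h2
  obtain ⟨he, hi⟩ := h1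
  obtain ⟨he', hj⟩ := h2
  have hsub : (φ ⟨e, he⟩).1 ⊆ (Finset.univ.erase i).erase j := by
    intro x hx
    rw [Finset.mem_erase, Finset.mem_erase]
    exact ⟨fun h => hj (h ▸ hx), fun h => hi (h ▸ hx), Finset.mem_univ _⟩
  have hcard := Finset.card_le_card hsub
  rw [Finset.card_erase_of_mem (by simpa using hij.symm), Finset.card_erase_of_mem (by simp),
    (φ ⟨e, he⟩).2, Finset.card_univ, Fintype.card_fin] at hcard
  have := i.2
  have := j.2
  have : (i : ℕ) ≠ j := fun h => hij (Fin.ext h)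
  omega

theorem cyclesSuffice_two (hr : 2 ≤ r) : CyclesSuffice r (r - 1) 2 := by
  intro n φ
  have hij : (⟨0, by omega⟩ : Fin r) ≠ ⟨1, by omega⟩ := by simp
  generalize (⟨0, by omega⟩ : Fin r) = i, (⟨1, by omega⟩ : Fin r) = j at hij
  -- Loops are not edges, so reflexivity holds vacuously.
  have hrefl : ∀ (i : Fin r) (x : Fin n), HasColour φ i s(x, x) := fun i x he => by simp at he
  have hpair : IsTotalPair (fun x y => HasColour φ i s(x, y)) (fun x y => HasColour φ j s(x, y)) :=
    { refl_left := hrefl i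
      refl_right := hrefl j
      symm_left := fun {x y} h => by rwa [Sym2.eq_swap]
      symm_right := fun {x y} h => by rwa [Sym2.eq_swap]
      total := fun x y => hasColour_or_of_ne φ hij _ }
  obtain ⟨l, m, hp, hl, hm⟩ := hpair.exists_two_closedChains (Finset.univ : Finset (Fin n)).toList
  have hnd : (l ++ m).Nodup := hp.nodup_iff.2 (Finset.nodup_toList _)
  rw [List.nodup_append'] at hnd
  have hset : ∀ l : List (Fin n), l.Nodup → l.toFinset ≠ ∅ →
      (IsClosedChain (fun x y => HasColour φ i s(x, y)) l ∨
        IsClosedChain (fun x y => HasColour φ j s(x, y)) l) → IsMonoCycleSet φ l.toFinset := by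
    intro l hnd hne hl
    have hne' : l ≠ [] := by simpa using hne
    exact hl.elim (fun h => h.isMonoCycleSet hne' hnd) fun h => h.isMonoCycleSet hne' hnd
  have hdisj : Disjoint l.toFinset m.toFinset := by
    rw [List.disjoint_toFinset_iff_disjoint]
    exact hnd.2.2
  -- Either list may be empty, and the empty set is not a part.
  refine ⟨Finpartition.ofErase {l.toFinset, m.toFinset} ?_ ?_, ?_, ?_⟩
  · intro s hs x hx hxs
    simp only [Finset.mem_insert, Finset.mem_singleton] at hx
    rw [Finset.disjoint_left]
    intro v hv hvs
    obtain ⟨y, hy, hvy⟩ := Finset.mem_sup.1 hvs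
    have hy' := hs hy
    simp only [Finset.mem_insert, Finset.mem_singleton] at hy'
    have hne : x ≠ y := fun h => hxs (h ▸ hy)
    rw [Finset.disjoint_left] at hdisj
    rcases hx with rfl | rfl <;> rcases hy' with rfl | rfl
    · exact hne rfl
    · exact hdisj hv hvy
    · exact hdisj hvy hv
    · exact hne rfl
  · ext v
    have := hp.mem_iff (a := v)
    simpa using this
  · exact (Finset.card_erase_le).trans Finset.card_le_two
  · intro S hS
    obtain ⟨hne, hS⟩ := Finset.mem_erase.1 hS
    simp only [Finset.mem_insert, Finset.mem_singleton] at hS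
    rcases hS with rfl | rfl
    · exact hset l hnd.1 hne hl
    · exact hset m hnd.2.1 hne hm

end Walks

/-! ### A colouring for which one path is not enough. -/

section LowerBound

/-- Each `s`-element is matched with its successor, a `t`-element; only the last entry may lack one.
A `t`-element at the head is unmatched and makes up for it, which the induction needs. -/
theorem countP_le_countP_add_one {α : Type*} {s t : α → Bool} (hst : ∀ x, s x → ¬t x)
    (l : List α) (hl : l.IsChain fun x y => s x → t y) :
    l.countP s ≤ l.countP t + 1 ∧ ((∀ x ∈ l.head?, t x) → l.countP s ≤ l.countP t) := by
  induction l with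
  | nil => simp
  | cons a l ih =>
    rw [List.isChain_cons] at hl
    obtain ⟨ih1, ih2⟩ := ih hl.2
    simp only [List.countP_cons, List.head?_cons, Option.mem_some_iff, forall_eq']
    by_cases hs : s a
    · have := ih2 fun x hx => hl.1 x hx hs
      have := hst a hs
      constructor
      · simp [hs]
        omega
      · intro h
        exact absurd h this
    · constructor
      · simp [hs]
        omega
      · intro h
        simp [hs, h]
        omega

/-- The level of a vertex: there are `2 ^ (i + 1)` vertices of level `i`. -/
def level (x : ℕ) : ℕ := Nat.log 2 (x + 2) - 1

theorem one_le_log (x : ℕ) : 1 ≤ Nat.log 2 (x + 2) :=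
  Nat.log_pos (by norm_num) (by omega)

theorem level_lt_iff {x i : ℕ} : level x < i + 1 ↔ x + 2 < 2 ^ (i + 2) := by
  rw [← Nat.log_lt_iff_lt_pow (by norm_num) (by omega), level]
  have := one_le_log x
  omega

theorem level_lt_iff' {x i : ℕ} : level x < i ↔ x + 2 < 2 ^ (i + 1) := by
  rcases i with _ | i
  · simp
  · exact level_lt_iff

theorem level_lt {r : ℕ} (x : Fin (2 ^ (r + 1) - 2)) : level x < r := by
  rw [level_lt_iff']
  have := x.2
  omega

/-- An edge receives all colours but the smaller one of the levels of its ends. -/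
def levelColouring (r : ℕ) : Colouring (⊤ : SimpleGraph (Fin (2 ^ (r + 1) - 2))) r (r - 1) :=
  fun e => ⟨Finset.univ.erase (e.1.map fun x : Fin (2 ^ (r + 1) - 2) =>
    (⟨level x.1, level_lt x⟩ : Fin r)).inf, by simp⟩

theorem card_level_lt {r i : ℕ} (hi : i ≤ r) :
    (Finset.univ.filter fun x : Fin (2 ^ (r + 1) - 2) => level x < i).card = 2 ^ (i + 1) - 2 := by
  have hpow : 2 ^ (i + 1) ≤ 2 ^ (r + 1) := Nat.pow_le_pow_right (by norm_num) (by omega)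
  have : (Finset.univ.filter fun x : Fin (2 ^ (r + 1) - 2) => level x < i) =
      Finset.univ.filter fun x : Fin (2 ^ (r + 1) - 2) => (x : ℕ) < 2 ^ (i + 1) - 2 := by
    ext x
    simp only [Finset.mem_filter, Finset.mem_univ, true_and, level_lt_iff']
    omega
  rw [this, Fin.card_filter_val_lt]
  omega

/-- An edge from level `i` to a level at least `i` has minimum `i`, exactly the colour it omits. -/
theorem isChain_support_of_hasColour {r : ℕ} {i : Fin r} {u v : Fin (2 ^ (r + 1) - 2)}
    (p : (⊤ : SimpleGraph (Fin (2 ^ (r + 1) - 2))).Walk u v)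
    (hp : ∀ e ∈ p.edges, HasColour (levelColouring r) i e) :
    p.support.IsChain fun x y : Fin (2 ^ (r + 1) - 2) => level x = i → level y < i := by
  induction p with
  | nil => simp
  | @cons u v w h p ih =>
    rw [SimpleGraph.Walk.support_cons, List.isChain_cons]
    rw [SimpleGraph.Walk.edges_cons, List.forall_mem_cons] at hp
    refine ⟨fun y hy hu => ?_, ih hp.2⟩
    obtain rfl : v = y := by
      rw [← SimpleGraph.Walk.cons_tail_support, List.head?_cons] at hy
      simpa using hy
    have := hp.1 (by simpa using h)
    simp only [levelColouring, Finset.mem_erase, Sym2.map_mk, Sym2.inf_mk] at this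
    by_contra hlt
    refine this.1 ((inf_eq_left.2 ?_).trans (Fin.ext hu)).symm
    rw [Fin.mk_le_mk]
    omega

theorem two_le_of_pathsSuffice {r m : ℕ} (hr : 2 ≤ r) (h : PathsSuffice r (r - 1) m) : 2 ≤ m := by
  by_contra hm
  obtain ⟨P, hP, hpath⟩ := h _ (levelColouring r)
  have hpow : 2 ^ 3 ≤ 2 ^ (r + 1) := Nat.pow_le_pow_right (by norm_num) (by omega)
  have hcard : 0 < 2 ^ (r + 1) - 2 := by omega
  obtain ⟨S, hS, -⟩ := P.exists_mem (Finset.mem_univ (⟨0, hcard⟩ : Fin (2 ^ (r + 1) - 2)))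
  have hall : ∀ x, x ∈ S := by
    intro x
    obtain ⟨T, hT, hx⟩ := P.exists_mem (Finset.mem_univ x)
    rwa [Finset.card_le_one.1 (by omega : P.parts.card ≤ 1) S hS T hT]
  obtain ⟨u, v, p, hp, hmono, hsupp⟩ := hpath S hS
  obtain ⟨i, hi⟩ := isMonochromatic_iff.1 hmono
  have hchain := isChain_support_of_hasColour p hi
  have hcount := (countP_le_countP_add_one
    (s := fun x : Fin (2 ^ (r + 1) - 2) => decide (level x = i))
    (t := fun x => decide (level x < i)) (by simp; omega) p.support (by simpa using hchain)).1
  have hcountP : ∀ q : Fin (2 ^ (r + 1) - 2) → Bool,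
      p.support.countP q = (Finset.univ.filter fun x => q x).card := by
    intro q
    have : (Finset.univ.filter fun x => q x) = (p.support.filter q).toFinset := by
      ext x
      simp [(hsupp x).1 (hall x)]
    rw [this, List.toFinset_card_of_nodup (hp.support_nodup.filter _), List.countP_eq_length_filter]
  rw [hcountP, hcountP] at hcount
  simp only [decide_eq_true_eq] at hcount
  -- Level `i` has `2 ^ (i + 1)` vertices and the levels below it `2 ^ (i + 1) - 2`, a gap of two
  -- where `hcount` allows one.
  have h1 := card_level_lt (r := r) (i := i) i.2.le
  have h2 := card_level_lt (r := r) (i := i + 1) i.2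
  have h3 : (Finset.univ.filter fun x : Fin (2 ^ (r + 1) - 2) => level x < i + 1).card =
      (Finset.univ.filter fun x : Fin (2 ^ (r + 1) - 2) => level x < i).card +
      (Finset.univ.filter fun x : Fin (2 ^ (r + 1) - 2) => level x = i).card := by
    rw [← Finset.card_union_of_disjoint]
    · congr 1
      ext x
      simp only [Finset.mem_union, Finset.mem_filter, Finset.mem_univ, true_and]
      omega
    · rw [Finset.disjoint_filter]
      intro x _ hx
      omega
  have h4 : 2 ^ ((i : ℕ) + 1 + 1) = 2 * 2 ^ ((i : ℕ) + 1) := pow_succ' _ _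
  have h5 : 1 ≤ 2 ^ (i : ℕ) := Nat.one_le_two_pow
  have h6 : 2 ^ ((i : ℕ) + 1) = 2 * 2 ^ (i : ℕ) := pow_succ' _ _
  omega

end LowerBound

end SetColouring

theorem mainTheorem10 (r : ℕ) (hr : 2 ≤ r) :
    SetColouring.IsCyclePartitionNumber r (r - 1) 2 ∧
      SetColouring.IsPathPartitionNumber r (r - 1) 2 := by
  have h := SetColouring.cyclesSuffice_two hr
  exact ⟨⟨h, fun m hm => SetColouring.two_le_of_pathsSuffice hr
      (SetColouring.CyclesSuffice.pathsSuffice hm)⟩,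
    h.pathsSuffice, fun m hm => SetColouring.two_le_of_pathsSuffice hr hm⟩
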